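/- Let $\mu$ be a probability measure on a measurable space $\mathcal X$. Let $\|\cdot\|$ be the norm and $d_2$ the distance of $\mathbb L_2(\mu)$, and write $d_2(s,\overline S)=\inf_{t\in\overline S}d_2(s,t)$. Let $\overline{\mathbb L}_2$ be the set of $t\in\mathbb L_2(\mu)$ with $t\ge 0$ and $\int t\,d\mu=1$, and $\overline{\mathbb L}^\Gamma_\infty$ the set of $t\in\overline{\mathbb L}_2$ with $\|t\|_\infty\le\Gamma$. For $s\in\overline{\mathbb L}_2$, $\mathbb E_s$ is the expectation when $\boldsymbol X=(X_1,\dots,X_n)$, $n\ge1$, is an i.i.d. sample with density $s$ with respect to $\mu$, and $Q_s(z)=\int_{\{s>z\}}(s-z)^2\,d\mu$. A subset $\overline S$ of $\mathbb L_2(\mu)$ has a metric dimension bounded by $D$ if for every $\eta>0$ there is a set $S_\eta\subset\mathbb L_2(\mu)$ such that each $t\in\overline S$ has some $t'\in S_\eta$ with $d_2(t,t')\le\eta$, and such that, for all $x\ge2$ and all $t\in\mathbb L_2(\mu)$, the open ball of center $t$ and radius $x\eta$ contains at most $\exp[Dx^2]$ points of $S_\eta$. Let $S$ be a countable subset of $\mathbb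 L_2(\mu)$ and, for each pair $\{t,u\}$ of distinct points of $S$, let $\psi_{\{t,u\}}(\boldsymbol X)$ be a test between $t$ and $u$, i.e. a measurable function of $\boldsymbol X$ with values in $\{t,u\}$. For $t\in S$ let $\mathcal D_{\boldsymbol X}(t)\in[0,+\infty]$ be the supremum of $d_2(t,u)$ over the $u\in S\setminus\{t\}$ such that $\psi_{\{t,u\}}(\boldsymbol X)=u$ ($0$ if there is none). A T-estimator derived from $S$ and these tests is a measurable function $\hat s=\hat s(\boldsymbol X)$ with values in $S$ such that $\mathcal D_{\boldsymbol X}(\hat s)=\inf_{t\in S}\mathcal D_{\boldsymbol X}(t)$. Theorem. There are constants $C_q$, depending only on $q$, and a universal constant $C$ with the following property. Let $\mu$ and $n\ge1$ be as above, let $\{\overline S_m,m\in\mathcal M\}$ be a finite or countable collection of non-empty subsets of $\mathbb L_2(\mu)$ with metric dimensions bounded respectively by $\overline D_m\ge1/2$, and let $\{\Delta_m,m\in\mathcal M\}$ be real weights with $$1\le\sum_{m\in\mathcal M}\exp[-\Delta_m]=\Sigma<+\infty .$$ Then for each $\Gamma\ge3$ there is a T-estimator $\hat s^\Gamma$, derived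 from some countable subset of $\overline{\mathbb L}^\Gamma_\infty$ and some family of tests, such that for all $s\in\overline{\mathbb L}_2$ and all $q\ge1$ $$\mathbb E_s\left[\|s-\hat s^\Gamma\|^q\right]\le C_q\,\Sigma\left[\inf_{m\in\mathcal M}\left\{d_2(s,\overline S_m)+\sqrt{\frac{\Gamma(\overline D_m\vee\Delta_m)}{n}}\right\}+\sqrt{Q_s(\Gamma)}\right]^q ,$$ and, for all $s\in\overline{\mathbb L}_2$ with $\|s\|_\infty\le\Gamma$, $$\mathbb E_s\left[\|s-\hat s^\Gamma\|^2\right]\le C\,\Sigma\inf_{m\in\mathcal M}\left\{d_2^2(s,\overline S_m)+\frac{\Gamma(\overline D_m\vee\Delta_m)}{n}\right\}.$$ -/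

import Mathlib

open MeasureTheory Set
open scoped ENNReal

/-- `S` (a subset of the metric space `M`) has a metric dimension bounded by `D`: for each `η > 0`
there is an `η`-net `N ⊆ M` for `S` such that each open ball of radius `x * η`, `x ≥ 2`, centred
anywhere in `M`, contains at most `exp (D * x ^ 2)` points of `N`. -/
def HasMetricDimLE {M : Type*} [MetricSpace M] (S : Set M) (D : ℝ) : Prop :=
  ∀ η : ℝ, 0 < η → ∃ N : Set M,
    (∀ t ∈ S, ∃ t' ∈ N, dist t t' ≤ η) ∧
    ∀ x : ℝ, 2 ≤ x → ∀ t : M,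
      (N ∩ Metric.ball t (x * η)).Finite ∧
        ((N ∩ Metric.ball t (x * η)).ncard : ℝ) ≤ Real.exp (D * x ^ 2)

/-- The probability densities with respect to `μ` that belong to `L₂(μ)`. -/
def densitiesL2 {X : Type*} [MeasurableSpace X] (μ : Measure X) : Set (Lp ℝ 2 μ) :=
  {t | (∀ᵐ x ∂μ, 0 ≤ t x) ∧ ∫ x, t x ∂μ = 1}

/-- The probability densities with respect to `μ` whose `L_∞(μ)`-norm is at most `Γ`. -/
def boundedDensities {X : Type*} [MeasurableSpace X] (μ : Measure X) (Γ : ℝ) :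
    Set (Lp ℝ 2 μ) :=
  {t | t ∈ densitiesL2 μ ∧ eLpNorm t ∞ μ ≤ ENNReal.ofReal Γ}

/-- The law `P_s^{⊗ n}`, `P_s = s · μ`, of an i.i.d. sample of size `n` with density `s`. -/
noncomputable def sampleLaw {X : Type*} [MeasurableSpace X] (μ : Measure X) (s : Lp ℝ 2 μ)
    (n : ℕ) : Measure (Fin n → X) :=
  Measure.pi fun _ => μ.withDensity fun x => ENNReal.ofReal (s x)

/-- `E_s ‖s - ŝ(X₁, …, Xₙ)‖ ^ q`, as an element of `[0, ∞]`. -/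
noncomputable def risk {X : Type*} [MeasurableSpace X] (μ : Measure X) (s : Lp ℝ 2 μ) (n : ℕ)
    (q : ℝ) (est : (Fin n → X) → Lp ℝ 2 μ) : ℝ≥0∞ :=
  ∫⁻ ω, edist s (est ω) ^ q ∂(sampleLaw μ s n)

/-- `Q_s(z) = ∫_{s > z} (s - z)² dμ`. -/
noncomputable def excess {X : Type*} [MeasurableSpace X] (μ : Measure X) (s : Lp ℝ 2 μ)
    (z : ℝ) : ℝ :=
  ∫ x in {x | z < s x}, (s x - z) ^ 2 ∂μ

/-- `ψ` is a family of tests between the pairs `{t, u}` of distinct points of `S`: `ψ t u` is a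
measurable function of the observation with values in `{t, u}` (its value is the decision) that
depends only on the unordered pair. -/
structure IsTestFamily {Ω M : Type*} [MeasurableSpace Ω] [MetricSpace M] (S : Set M)
    (ψ : M → M → Ω → M) : Prop where
  stronglyMeasurable : ∀ t ∈ S, ∀ u ∈ S, t ≠ u → StronglyMeasurable (ψ t u)
  mem_pair : ∀ t ∈ S, ∀ u ∈ S, t ≠ u → ∀ ω, ψ t u ω = t ∨ ψ t u ω = u
  symm : ∀ t ∈ S, ∀ u ∈ S, t ≠ u → ψ t u = ψ u t

/-- The points of `S` that are preferred to `t` by the tests, given the observation `ω`. -/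
def preferred {Ω M : Type*} (S : Set M) (ψ : M → M → Ω → M) (ω : Ω) (t : M) : Set M :=
  {u | u ∈ S ∧ u ≠ t ∧ ψ t u ω = u}

/-- The largest distance from `t` to a point of `S` that is preferred to `t` (`0` if there is no
such point). -/
noncomputable def testCriterion {Ω M : Type*} [MetricSpace M] (S : Set M)
    (ψ : M → M → Ω → M) (ω : Ω) (t : M) : ℝ≥0∞ :=
  ⨆ u ∈ preferred S ψ ω t, edist t u

/-- `est` is a T-estimator derived from the countable set `S` and the family of tests `ψ`:
a measurable minimizer over `S` of the criterion. -/
structure IsTEstimator {Ω M : Type*} [MeasurableSpace Ω] [MetricSpace M] (S : Set M)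
    (ψ : M → M → Ω → M) (est : Ω → M) : Prop where
  countable : S.Countable
  isTestFamily : IsTestFamily S ψ
  stronglyMeasurable : StronglyMeasurable est
  mem : ∀ ω, est ω ∈ S
  minimizes : ∀ ω, ∀ t ∈ S, testCriterion S ψ ω (est ω) ≤ testCriterion S ψ ω t

/-! Penalized least squares over a finite set of bounded densities is a T-estimator: if every test
prefers the smaller penalized contrast, the minimizer is never rejected, its criterion is `0`, and
its risk can be studied directly.

For bounded `t`, `u`, the contrast difference has mean `‖s - t‖² - ‖s - u‖²` plus the penalty
difference. Its exponential moment at scale `n / Γ` has a variance term bounded by `‖u - t‖²` and,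
since `s` may exceed `Γ`, by the excess (`lintegral_exp_mul_sub_le`). A union bound over the
possible values `u` of the estimator then bounds the exponential moment of the loss
(`lintegral_exp_dist_sq_le`), provided the sum over `u` of Gaussian weights times exponentials of
penalties is of order `Sig`.

The set comes from `exists_penalized_net`: each model is discretized at a scale proportional to `τ`,
where `τ² = Γ (D ∨ Δ) / n`, and its net is moved into the bounded densities. The metric dimension
controls the Gaussian sum over the net, and the penalty absorbs it together with the weight `Δ`.
Finiteness costs nothing: the bounded densities have diameter at most `2√Γ`, so what is discarded
would only serve bounds that hold trivially. -/

section L2Facts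

/-! ### Densities in `L₂`: truncation and exponential moments of one observation. -/

variable {X : Type*} [MeasurableSpace X] {μ : Measure X}

lemma memLp_two_coe (s : Lp ℝ 2 μ) : MemLp (fun x => s x) 2 μ := Lp.memLp s

lemma integrable_coe [IsFiniteMeasure μ] (s : Lp ℝ 2 μ) : Integrable (fun x => s x) μ :=
  (memLp_two_coe s).integrable (by norm_num)

lemma inner_eq_integral_mul (s t : Lp ℝ 2 μ) : inner ℝ s t = ∫ x, s x * t x ∂μ := by
  rw [L2.inner_def]
  exact integral_congr_ae (Filter.Eventually.of_forall fun x => by simp [mul_comm])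

lemma norm_sq_eq_integral_sq (s : Lp ℝ 2 μ) : ‖s‖ ^ 2 = ∫ x, s x ^ 2 ∂μ := by
  rw [← real_inner_self_eq_norm_sq, inner_eq_integral_mul]
  simp_rw [sq]

lemma norm_sub_sq_eq_integral (s t : Lp ℝ 2 μ) :
    ‖s - t‖ ^ 2 = ∫ x, (s x - t x) ^ 2 ∂μ := by
  rw [norm_sq_eq_integral_sq]
  refine integral_congr_ae ?_
  filter_upwards [Lp.coeFn_sub s t] with x hx
  rw [hx, Pi.sub_apply]

lemma memLp_pos_part_sub [IsFiniteMeasure μ] (s : Lp ℝ 2 μ) (z : ℝ) :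
    MemLp (fun x => max (s x - z) 0) 2 μ :=
  ((memLp_two_coe s).sub (memLp_const z)).pos_part

lemma excess_eq_integral_pos_part_sq (s : Lp ℝ 2 μ) (z : ℝ) :
    excess μ s z = ∫ x, max (s x - z) 0 ^ 2 ∂μ := by
  have hm : MeasurableSet {x | z < s x} :=
    measurableSet_lt measurable_const (Lp.stronglyMeasurable s).measurable
  rw [excess, ← integral_indicator hm]
  refine integral_congr_ae (Filter.Eventually.of_forall fun x => ?_)
  by_cases h : z < s x
  · simp [indicator, h, max_eq_left (sub_nonneg.2 h.le)]
  · simp [indicator, h, max_eq_right (sub_nonpos.2 (not_lt.1 h))]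

lemma excess_nonneg (s : Lp ℝ 2 μ) (z : ℝ) : 0 ≤ excess μ s z := by
  rw [excess_eq_integral_pos_part_sq]
  exact integral_nonneg fun x => sq_nonneg _

lemma ae_le_of_eLpNorm_top_le {s : Lp ℝ 2 μ} {Γ : ℝ} (hΓ : 0 ≤ Γ)
    (h : eLpNorm s ∞ μ ≤ ENNReal.ofReal Γ) : ∀ᵐ x ∂μ, |s x| ≤ Γ := by
  rw [eLpNorm_exponent_top] at h
  filter_upwards [ae_le_eLpNormEssSup (f := (s : X → ℝ)) (μ := μ)] with x hx
  have := hx.trans h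
  rw [← ofReal_norm, ENNReal.ofReal_le_ofReal_iff hΓ] at this
  simpa using this

lemma eLpNorm_top_le_of_ae_le {s : X → ℝ} {Γ : ℝ}
    (h : ∀ᵐ x ∂μ, |s x| ≤ Γ) : eLpNorm s ∞ μ ≤ ENNReal.ofReal Γ := by
  rw [eLpNorm_exponent_top]
  refine eLpNormEssSup_le_of_ae_bound (h.mono fun x hx => ?_)
  simpa using hx

lemma excess_eq_zero_of_le {s : Lp ℝ 2 μ} {Γ : ℝ} (hΓ : 0 ≤ Γ)
    (h : eLpNorm s ∞ μ ≤ ENNReal.ofReal Γ) : excess μ s Γ = 0 := by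
  rw [excess_eq_integral_pos_part_sq]
  refine integral_eq_zero_of_ae ?_
  filter_upwards [ae_le_of_eLpNorm_top_le hΓ h] with x hx
  simp [max_eq_right (sub_nonpos.2 ((le_abs_self _).trans hx))]

lemma ae_mem_Icc_of_mem_boundedDensities {t : Lp ℝ 2 μ} {Γ : ℝ} (hΓ : 0 ≤ Γ)
    (ht : t ∈ boundedDensities μ Γ) : ∀ᵐ x ∂μ, 0 ≤ t x ∧ t x ≤ Γ := by
  filter_upwards [ht.1.1, ae_le_of_eLpNorm_top_le hΓ ht.2] with x h1 h2
  exact ⟨h1, (le_abs_self _).trans h2⟩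

lemma norm_sq_le_of_mem_boundedDensities [IsFiniteMeasure μ] {t : Lp ℝ 2 μ} {Γ : ℝ} (hΓ : 0 ≤ Γ)
    (ht : t ∈ boundedDensities μ Γ) : ‖t‖ ^ 2 ≤ Γ := by
  calc ‖t‖ ^ 2 = ∫ x, t x ^ 2 ∂μ := norm_sq_eq_integral_sq t
    _ ≤ ∫ x, Γ * t x ∂μ := by
      refine integral_mono_ae (memLp_two_coe t).integrable_sq ((integrable_coe t).const_mul Γ) ?_
      filter_upwards [ae_mem_Icc_of_mem_boundedDensities hΓ ht] with x hx
      nlinarith [hx.1, hx.2]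
    _ = Γ := by rw [integral_const_mul, ht.1.2, mul_one]

/-- This diameter bound makes the risk bound trivial whenever the claimed error is at least of order
`√Γ`. -/
lemma dist_le_of_mem_boundedDensities [IsFiniteMeasure μ] {t u : Lp ℝ 2 μ} {Γ : ℝ} (hΓ : 0 ≤ Γ)
    (ht : t ∈ boundedDensities μ Γ) (hu : u ∈ boundedDensities μ Γ) :
    dist t u ≤ 2 * Real.sqrt Γ := by
  have h1 := Real.le_sqrt_of_sq_le (norm_sq_le_of_mem_boundedDensities hΓ ht)
  have h2 := Real.le_sqrt_of_sq_le (norm_sq_le_of_mem_boundedDensities hΓ hu)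
  rw [dist_eq_norm]
  linarith [norm_sub_le t u]

/-- Truncate `s` at `Γ` and restore the lost mass `m` by moving a fraction `α` of the way to the
constant `Γ`, which keeps the values in `[0, Γ]`. The correction is at most `3/2 * m`, and `m²` is
at most the excess by Cauchy–Schwarz. -/
lemma exists_mem_boundedDensities_dist_le [IsProbabilityMeasure μ] {s : Lp ℝ 2 μ} {Γ : ℝ}
    (hΓ : 3 ≤ Γ) (hs : s ∈ densitiesL2 μ) :
    ∃ r ∈ boundedDensities μ Γ, dist s r ≤ 3 * Real.sqrt (excess μ s Γ) := by
  set g : X → ℝ := fun x => max (s x - Γ) 0 with hg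
  have hgL : MemLp g 2 μ := memLp_pos_part_sub s Γ
  have hgi : Integrable g μ := hgL.integrable (by norm_num)
  have hg0 : ∀ x, 0 ≤ g x := fun x => le_max_right _ _
  have hsi := integrable_coe s
  set m := ∫ x, g x ∂μ with hm
  have hm0 : 0 ≤ m := integral_nonneg hg0
  have hm1 : m ≤ 1 := by
    rw [← hs.2]
    refine integral_mono_ae hgi hsi ?_
    filter_upwards [hs.1] with x hx
    exact max_le (by linarith) hx
  have hden : 0 < Γ - 1 + m := by linarith
  -- The gap between `Γ` and the truncated density has mass `Γ - (1 - m)`, so this fraction of it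
  -- has mass exactly `m`.
  set α := m / (Γ - 1 + m) with hα
  have hα0 : 0 ≤ α := by positivity
  have hα1 : α ≤ 1 := by rw [hα, div_le_one hden]; linarith
  have hαm : α * (Γ - 1 + m) = m := by rw [hα]; field_simp
  -- Here `3 ≤ Γ` enters, as `Γ ≤ 3/2 * (Γ - 1)`.
  have hαΓ : α * Γ ≤ 3 / 2 * m := by
    have : α * (Γ - 1) ≤ m := by nlinarith
    nlinarith
  set r : X → ℝ := fun x => (s x - g x) + α * (Γ - (s x - g x)) with hr
  have hh : ∀ x, s x - g x ≤ Γ := fun x => by linarith [le_max_left (s x - Γ) 0]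
  have hh0 : ∀ᵐ x ∂μ, 0 ≤ s x - g x := by
    filter_upwards [hs.1] with x hx
    exact sub_nonneg.2 (max_le (by linarith) hx)
  have hr0 : ∀ᵐ x ∂μ, 0 ≤ r x ∧ r x ≤ Γ := by
    filter_upwards [hh0] with x hx
    have := hh x
    constructor
    · have : 0 ≤ α * (Γ - (s x - g x)) := mul_nonneg hα0 (by linarith)
      simp only [hr]; linarith
    · simp only [hr]; nlinarith
  have hrL : MemLp r 2 μ :=
    ((memLp_two_coe s).sub hgL).add (((memLp_const Γ).sub ((memLp_two_coe s).sub hgL)).const_mul α)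
  have hrint : ∫ x, r x ∂μ = 1 := by
    have hhi : Integrable (fun x => s x - g x) μ := hsi.sub hgi
    have hki : Integrable (fun x => Γ - (s x - g x)) μ := (integrable_const Γ).sub hhi
    have e1 : ∫ x, (s x - g x) ∂μ = 1 - m := by rw [integral_sub hsi hgi, hs.2]
    have e2 : ∫ x, (Γ - (s x - g x)) ∂μ = Γ - (1 - m) := by
      rw [integral_sub (integrable_const _) hhi, e1]; simp
    simp only [hr]
    rw [integral_add hhi (hki.const_mul α), integral_const_mul, e1, e2]
    linarith
  have hco := hrL.coeFn_toLp
  refine ⟨hrL.toLp r, ⟨⟨?_, ?_⟩, ?_⟩, ?_⟩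
  · filter_upwards [hco, hr0] with x h1 h2
    rw [h1]; exact h2.1
  · rw [integral_congr_ae hco, hrint]
  · refine eLpNorm_top_le_of_ae_le ?_
    filter_upwards [hco, hr0] with x h1 h2
    rw [h1, abs_of_nonneg h2.1]; exact h2.2
  · have hgsq := hgL.integrable_sq
    have hmsq : m ^ 2 ≤ ∫ x, g x ^ 2 ∂μ := by
      have h0 : 0 ≤ ∫ x, (g x - m) ^ 2 ∂μ := integral_nonneg fun x => sq_nonneg _
      have : ∫ x, (g x - m) ^ 2 ∂μ = ∫ x, g x ^ 2 ∂μ - m ^ 2 := by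
        have e : ∀ x, (g x - m) ^ 2 = g x ^ 2 - (2 * m * g x - m ^ 2) := fun x => by ring
        simp_rw [e]
        have hli : Integrable (fun x => 2 * m * g x - m ^ 2) μ :=
          (hgi.const_mul _).sub (integrable_const _)
        rw [integral_sub hgsq hli, integral_sub (hgi.const_mul _) (integrable_const _), integral_const_mul, ← hm]
        simp; ring
      linarith
    have key : ‖s - hrL.toLp r‖ ^ 2 ≤ 9 * excess μ s Γ := by
      rw [norm_sub_sq_eq_integral, excess_eq_integral_pos_part_sq]
      calc ∫ x, (s x - (hrL.toLp r) x) ^ 2 ∂μ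
          ≤ ∫ x, (2 * g x ^ 2 + 9 / 2 * m ^ 2) ∂μ := by
            refine integral_mono_ae ((memLp_two_coe s).sub
              (memLp_two_coe (hrL.toLp r))).integrable_sq
              ((hgsq.const_mul 2).add (integrable_const _)) ?_
            filter_upwards [hco, hh0] with x h1 h2
            have h3 := hh x
            have h4 : 0 ≤ α * (Γ - (s x - g x)) := mul_nonneg hα0 (by linarith)
            have h5 : α * (Γ - (s x - g x)) ≤ 3 / 2 * m := by nlinarith
            have h6 := hg0 x
            have h7 : s x - (hrL.toLp r) x = g x - α * (Γ - (s x - g x)) := by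
              rw [h1]; simp only [hr]; ring
            simp only [h7]
            set b := α * (Γ - (s x - g x))
            nlinarith [sq_nonneg (g x + b)]
        _ = 2 * ∫ x, g x ^ 2 ∂μ + 9 / 2 * m ^ 2 := by
            rw [integral_add (hgsq.const_mul 2) (integrable_const _), integral_const_mul]; simp
        _ ≤ 9 * ∫ x, g x ^ 2 ∂μ := by nlinarith [sq_nonneg m]
    rw [dist_eq_norm]
    refine abs_le_of_sq_le_sq' ?_ (by positivity) |>.2
    rw [mul_pow, Real.sq_sqrt (excess_nonneg s Γ)]
    linarith

/-- An exponential moment bound for one observation, with a variance term controlled by the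
excess of the density over `Γ`. -/
lemma lintegral_exp_mul_sub_le [IsProbabilityMeasure μ] {s t u : Lp ℝ 2 μ} {Γ lam : ℝ}
    (hΓ : 0 ≤ Γ) (hlam : 0 ≤ lam) (hlamΓ : lam * Γ ≤ 1) (hs : s ∈ densitiesL2 μ)
    (ht : t ∈ boundedDensities μ Γ) (hu : u ∈ boundedDensities μ Γ) :
    ∫⁻ x, ENNReal.ofReal (Real.exp (lam * (u x - t x)))
        ∂(μ.withDensity fun x => ENNReal.ofReal (s x)) ≤
      ENNReal.ofReal (Real.exp (lam * inner ℝ s (u - t) +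
        lam ^ 2 * Γ * (3 / 2 * ‖u - t‖ ^ 2 + 1 / 2 * excess μ s Γ))) := by
  have hsm := (Lp.stronglyMeasurable s).measurable
  have htm := (Lp.stronglyMeasurable t).measurable
  have hum := (Lp.stronglyMeasurable u).measurable
  have hgsq := (memLp_pos_part_sub s Γ).integrable_sq
  have hfL := (memLp_two_coe u).sub (memLp_two_coe t)
  have hsf : Integrable (fun x => s x * (u x - t x)) μ := (memLp_two_coe s).integrable_mul hfL
  have hfsq : Integrable (fun x => (u x - t x) ^ 2) μ := hfL.integrable_sq
  have hsi := integrable_coe s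
  rw [lintegral_withDensity_eq_lintegral_mul _ hsm.ennreal_ofReal (by fun_prop)]
  calc ∫⁻ x, ((fun x => ENNReal.ofReal (s x)) *
          fun x => ENNReal.ofReal (Real.exp (lam * (u x - t x)))) x ∂μ
      ≤ ∫⁻ x, ENNReal.ofReal (s x + lam * (s x * (u x - t x)) + lam ^ 2 * Γ *
          (3 / 2 * (u x - t x) ^ 2 + 1 / 2 * max (s x - Γ) 0 ^ 2)) ∂μ := by
        refine lintegral_mono_ae ?_
        filter_upwards [hs.1, ae_mem_Icc_of_mem_boundedDensities hΓ ht,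
          ae_mem_Icc_of_mem_boundedDensities hΓ hu] with x h0 h1 h2
        rw [Pi.mul_apply, ← ENNReal.ofReal_mul h0]
        refine ENNReal.ofReal_le_ofReal ?_
        set f := u x - t x
        have hf1 : |f| ≤ Γ := abs_le.2 ⟨by linarith, by linarith⟩
        have hy : |lam * f| ≤ 1 := by
          rw [abs_mul, abs_of_nonneg hlam]
          exact (mul_le_mul_of_nonneg_left hf1 hlam).trans hlamΓ
        have he := (abs_le.1 (Real.abs_exp_sub_one_sub_id_le hy)).2
        -- With `s ≤ Γ + g` and `|f| ≤ Γ`, the unbounded part satisfies `g f² ≤ Γ g |f| ≤ Γ (g² +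
        -- f²) / 2`: large values of `s` cost only the excess.
        have hsf2 : s x * f ^ 2 ≤ Γ * (3 / 2 * f ^ 2 + 1 / 2 * max (s x - Γ) 0 ^ 2) := by
          set g := max (s x - Γ) 0
          have hg0 : 0 ≤ g := le_max_right _ _
          have hsg : s x ≤ Γ + g := by linarith [le_max_left (s x - Γ) 0]
          have h3 : g * |f| * |f| ≤ g * |f| * Γ :=
            mul_le_mul_of_nonneg_left hf1 (by positivity)
          have h4 : s x * f ^ 2 ≤ (Γ + g) * f ^ 2 := mul_le_mul_of_nonneg_right hsg (sq_nonneg f)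
          have h5 : Γ * (2 * (g * |f|)) ≤ Γ * (g ^ 2 + f ^ 2) :=
            mul_le_mul_of_nonneg_left (by nlinarith [sq_nonneg (g - |f|), sq_abs f]) hΓ
          nlinarith [sq_abs f]
        have h6 : s x * Real.exp (lam * f) ≤ s x * (1 + lam * f + (lam * f) ^ 2) :=
          mul_le_mul_of_nonneg_left (by linarith) h0
        have h7 := mul_le_mul_of_nonneg_left hsf2 (sq_nonneg lam)
        nlinarith
    _ = ENNReal.ofReal (1 + lam * inner ℝ s (u - t) +
        lam ^ 2 * Γ * (3 / 2 * ‖u - t‖ ^ 2 + 1 / 2 * excess μ s Γ)) := by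
        have hin : inner ℝ s (u - t) = ∫ x, s x * (u x - t x) ∂μ := by
          rw [inner_eq_integral_mul]
          refine integral_congr_ae ?_
          filter_upwards [Lp.coeFn_sub u t] with x hx
          simp only [hx, Pi.sub_apply]
        have hA := hsi.add (hsf.const_mul lam)
        have hB := ((hfsq.const_mul (3 / 2)).add (hgsq.const_mul (1 / 2))).const_mul (lam ^ 2 * Γ)
        rw [← ofReal_integral_eq_lintegral_ofReal]
        · have e1 : ∫ x, (s x + lam * (s x * (u x - t x))) ∂μ = 1 + lam * inner ℝ s (u - t) := by
            rw [integral_add hsi (hsf.const_mul lam), integral_const_mul, hs.2, hin]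
          have e2 : ∫ x, lam ^ 2 * Γ *
              (3 / 2 * (u x - t x) ^ 2 + 1 / 2 * max (s x - Γ) 0 ^ 2) ∂μ =
              lam ^ 2 * Γ * (3 / 2 * ‖u - t‖ ^ 2 + 1 / 2 * excess μ s Γ) := by
            rw [integral_const_mul, integral_add (hfsq.const_mul _) (hgsq.const_mul _),
              integral_const_mul, integral_const_mul, norm_sub_sq_eq_integral,
              excess_eq_integral_pos_part_sq]
          rw [← e1, ← e2]
          exact congrArg _ (integral_add hA hB)
        · exact hA.add hB
        · filter_upwards [hs.1, ae_mem_Icc_of_mem_boundedDensities hΓ ht,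
            ae_mem_Icc_of_mem_boundedDensities hΓ hu] with x h0 h1 h2
          have hf1 : -Γ ≤ u x - t x := by linarith
          have : 0 ≤ 1 + lam * (u x - t x) := by nlinarith
          have h3 : 0 ≤ s x * (1 + lam * (u x - t x)) := mul_nonneg h0 this
          have h4 : 0 ≤ lam ^ 2 * Γ *
            (3 / 2 * (u x - t x) ^ 2 + 1 / 2 * max (s x - Γ) 0 ^ 2) := by positivity
          simp only [Pi.zero_apply]
          linarith
    _ ≤ _ := ENNReal.ofReal_le_ofReal (by
        rw [add_assoc, add_comm 1]
        exact Real.add_one_le_exp _)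

lemma isProbabilityMeasure_withDensity_of_mem [IsFiniteMeasure μ] {s : Lp ℝ 2 μ}
    (hs : s ∈ densitiesL2 μ) :
    IsProbabilityMeasure (μ.withDensity fun x => ENNReal.ofReal (s x)) := by
  refine ⟨?_⟩
  rw [withDensity_apply _ MeasurableSet.univ, setLIntegral_univ, ← ofReal_integral_eq_lintegral_ofReal (integrable_coe s) hs.1, hs.2, ENNReal.ofReal_one]

lemma isProbabilityMeasure_sampleLaw [IsFiniteMeasure μ] {s : Lp ℝ 2 μ}
    (hs : s ∈ densitiesL2 μ) (n : ℕ) : IsProbabilityMeasure (sampleLaw μ s n) := by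
  have := isProbabilityMeasure_withDensity_of_mem hs
  unfold sampleLaw
  infer_instance

end L2Facts

/-! ### The penalized least squares T-estimator and its exponential moments. -/

section Estimator

/-- The tests that compare a real criterion, ties being broken by a fixed ranking, admit a
T-estimator, which minimizes the criterion. -/
lemma exists_isTEstimator_of_criterion {Ω M : Type*} [MeasurableSpace Ω] [MetricSpace M]
    {S : Finset M} (hS : S.Nonempty) {c : Ω → M → ℝ} (hc : ∀ t, Measurable fun ω => c ω t) :
    ∃ (ψ : M → M → Ω → M) (est : Ω → M), IsTEstimator (S : Set M) ψ est ∧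
      ∀ ω, ∀ t ∈ S, c ω (est ω) ≤ c ω t := by
  classical
  obtain ⟨rank, hrank⟩ : ∃ rank : M → ℕ, InjOn rank S := by
    have := S.countable_toSet
    exact Set.countable_iff_exists_injOn.1 this
  -- The lexicographic tie-break makes keys of distinct points distinct, so the decision depends
  -- only on the unordered pair.
  set key : Ω → M → ℝ ×ₗ ℕ := fun ω t => toLex (c ω t, rank t) with hkey
  have hinj : ∀ ω, ∀ t ∈ S, ∀ u ∈ S, key ω t = key ω u → t = u := by
    intro ω t ht u hu h
    have h2 : (c ω t, rank t) = (c ω u, rank u) := toLex.injective h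
    exact hrank ht hu (Prod.ext_iff.1 h2).2
  have hmeas : ∀ t u, MeasurableSet {ω | key ω t ≤ key ω u} := by
    intro t u
    have : {ω | key ω t ≤ key ω u} =
        {ω | c ω t < c ω u} ∪ ({ω | c ω t = c ω u} ∩ {_ω | rank t ≤ rank u}) := by
      ext ω
      simp [hkey, Prod.Lex.le_iff]
    rw [this]
    exact (measurableSet_lt (hc t) (hc u)).union
      ((measurableSet_eq_fun (hc t) (hc u)).inter (MeasurableSet.const _))
  have hex : ∀ ω, ∃ t ∈ S, ∀ u ∈ S, key ω t ≤ key ω u := fun ω =>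
    Finset.exists_min_image S (key ω) hS
  choose est hest hmin using hex
  have hpre : ∀ t ∈ S, MeasurableSet {ω | est ω = t} := by
    intro t ht
    have : {ω | est ω = t} = ⋂ u ∈ S, {ω | key ω t ≤ key ω u} := by
      ext ω
      simp only [mem_ofPred_eq, mem_iInter]
      constructor
      · rintro rfl u hu
        exact hmin ω u hu
      · intro h
        exact hinj ω _ (hest ω) _ ht (le_antisymm (hmin ω t ht) (h _ (hest ω)))
    rw [this]
    exact Finset.measurableSet_biInter S fun u _ => hmeas t u
  refine ⟨fun t u ω => if key ω t ≤ key ω u then t else u, est,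
    ⟨S.countable_toSet, ⟨?_, ?_, ?_⟩, ?_, hest, ?_⟩, ?_⟩
  · intro t _ u _ _
    exact StronglyMeasurable.ite (hmeas t u) stronglyMeasurable_const stronglyMeasurable_const
  · intro t _ u _ _ ω
    by_cases h : key ω t ≤ key ω u <;> simp [h]
  · intro t ht u hu htu
    funext ω
    have hne : key ω t ≠ key ω u := fun h => htu (hinj ω t ht u hu h)
    rcases lt_or_gt_of_ne hne with h | h
    · simp only [if_pos h.le, if_neg (not_le.2 h)]
    · simp only [if_pos h.le, if_neg (not_le.2 h)]
  · let f : SimpleFunc Ω M :=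
      { toFun := est
        measurableSet_fiber' := fun t => by
          by_cases ht : t ∈ S
          · exact hpre t ht
          · convert MeasurableSet.empty
            exact eq_empty_of_forall_notMem fun ω hω => ht (hω ▸ hest ω)
        finite_range' := S.finite_toSet.subset (range_subset_iff.2 hest) }
    exact f.stronglyMeasurable
  · intro ω t _
    have : preferred (S : Set M) (fun t u ω => if key ω t ≤ key ω u then t else u) ω (est ω) = ∅ := by
      refine eq_empty_of_forall_notMem fun u hu => ?_
      obtain ⟨hu1, hu2, hu3⟩ := hu
      simp only [if_pos (hmin ω u hu1)] at hu3
      exact hu2 hu3.symm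
    simp [testCriterion, this]
  · intro ω t ht
    have := hmin ω t ht
    rw [hkey, Prod.Lex.le_iff] at this
    rcases this with h | h
    · exact h.le
    · exact h.1.le

variable {X : Type*} [MeasurableSpace X] {μ : Measure X}

lemma lintegral_sampleLaw_prod [IsFiniteMeasure μ] {s : Lp ℝ 2 μ} (hs : s ∈ densitiesL2 μ) (n : ℕ)
    {g : X → ℝ≥0∞} (hg : Measurable g) :
    ∫⁻ ω, ∏ i, g (ω i) ∂(sampleLaw μ s n) =
      (∫⁻ x, g x ∂(μ.withDensity fun x => ENNReal.ofReal (s x))) ^ n := by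
  have := isProbabilityMeasure_withDensity_of_mem hs
  set ν := μ.withDensity fun x => ENNReal.ofReal (s x)
  have hind : ProbabilityTheory.iIndepFun (fun (i : Fin n) (ω : Fin n → X) => g (ω i))
      (Measure.pi fun _ => ν) :=
    ProbabilityTheory.iIndepFun_pi (X := fun _ : Fin n => g) fun _ => hg.aemeasurable
  have h := ProbabilityTheory.lintegral_prod_eq_prod_lintegral_of_indepFun Finset.univ
    (fun (i : Fin n) (ω : Fin n → X) => g (ω i)) hind (fun i => hg.comp (measurable_pi_apply i))
  rw [sampleLaw, h]
  have h2 : ∀ i : Fin n, ∫⁻ ω, g (ω i) ∂(Measure.pi fun _ => ν) = ∫⁻ x, g x ∂ν := fun i =>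
    (measurePreserving_eval (fun _ : Fin n => ν) i).lintegral_comp hg
  simp [h2]

/-- The penalized least squares contrast. -/
noncomputable def penalizedContrast (n : ℕ) (pen : Lp ℝ 2 μ → ℝ) (ω : Fin n → X)
    (t : Lp ℝ 2 μ) : ℝ :=
  ‖t‖ ^ 2 - 2 / n * ∑ i, t (ω i) + pen t

lemma measurable_penalizedContrast (n : ℕ) (pen : Lp ℝ 2 μ → ℝ) (t : Lp ℝ 2 μ) :
    Measurable fun ω : Fin n → X => penalizedContrast n pen ω t := by
  have := (Lp.stronglyMeasurable t).measurable
  unfold penalizedContrast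
  fun_prop

/-- Independence reduces the claim to one observation. The scale is small enough for the variance
term `‖u - t‖² / 2`, at most `dist s t ^ 2 + dist s u ^ 2`, to use up only half of the negative
drift `-2 * dist s u ^ 2`. -/
lemma lintegral_exp_penalizedContrast_sub_le [IsProbabilityMeasure μ] {s t u : Lp ℝ 2 μ} {Γ : ℝ}
    {n : ℕ} (hn : 1 ≤ n) (hΓ : 0 < Γ) (pen : Lp ℝ 2 μ → ℝ) (hs : s ∈ densitiesL2 μ)
    (ht : t ∈ boundedDensities μ Γ) (hu : u ∈ boundedDensities μ Γ) :
    ∫⁻ ω, ENNReal.ofReal (Real.exp (n / (24 * Γ) *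
        (penalizedContrast n pen ω t - penalizedContrast n pen ω u))) ∂(sampleLaw μ s n) ≤
      ENNReal.ofReal (Real.exp (n / (48 * Γ) * (3 * dist s t ^ 2 + excess μ s Γ + 2 * pen t
        - dist s u ^ 2 - 2 * pen u))) := by
  have hn0 : (0 : ℝ) < n := by exact_mod_cast hn
  set lam : ℝ := 1 / (12 * Γ) with hlam
  set K : ℝ := n / (24 * Γ) * (‖t‖ ^ 2 - ‖u‖ ^ 2 + pen t - pen u) with hK
  have htm := (Lp.stronglyMeasurable t).measurable
  have hum := (Lp.stronglyMeasurable u).measurable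
  have e1 : ∀ ω : Fin n → X, ENNReal.ofReal (Real.exp (n / (24 * Γ) *
        (penalizedContrast n pen ω t - penalizedContrast n pen ω u))) =
      ENNReal.ofReal (Real.exp K) *
        ∏ i, ENNReal.ofReal (Real.exp (lam * (u (ω i) - t (ω i)))) := by
    intro ω
    rw [← ENNReal.ofReal_prod_of_nonneg fun i _ => (Real.exp_pos _).le, ← Real.exp_sum,
      ← ENNReal.ofReal_mul (Real.exp_pos _).le, ← Real.exp_add, ← Finset.mul_sum,
      Finset.sum_sub_distrib]
    congr 2
    simp only [penalizedContrast, hK, hlam]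
    field_simp
    ring
  have hmgf := lintegral_exp_mul_sub_le (lam := lam) hΓ.le (by positivity)
    (by rw [hlam]; field_simp; norm_num) hs ht hu
  simp_rw [e1]
  rw [lintegral_const_mul _ (by fun_prop), lintegral_sampleLaw_prod hs n
    (g := fun x => ENNReal.ofReal (Real.exp (lam * (u x - t x)))) (by fun_prop)]
  calc _ ≤ ENNReal.ofReal (Real.exp K) * (ENNReal.ofReal (Real.exp (lam * inner ℝ s (u - t) +
        lam ^ 2 * Γ * (3 / 2 * ‖u - t‖ ^ 2 + 1 / 2 * excess μ s Γ)))) ^ n := by gcongr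
    _ = ENNReal.ofReal (Real.exp (K + n * (lam * inner ℝ s (u - t) +
        lam ^ 2 * Γ * (3 / 2 * ‖u - t‖ ^ 2 + 1 / 2 * excess μ s Γ)))) := by
      rw [← ENNReal.ofReal_pow (Real.exp_pos _).le, ← Real.exp_nat_mul,
        ← ENNReal.ofReal_mul (Real.exp_pos _).le, ← Real.exp_add]
    _ ≤ _ := by
      refine ENNReal.ofReal_le_ofReal (Real.exp_le_exp.2 ?_)
      have hst : dist s t ^ 2 = ‖s‖ ^ 2 - 2 * inner ℝ s t + ‖t‖ ^ 2 := by
        rw [dist_eq_norm, norm_sub_sq_real]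
      have hsu : dist s u ^ 2 = ‖s‖ ^ 2 - 2 * inner ℝ s u + ‖u‖ ^ 2 := by
        rw [dist_eq_norm, norm_sub_sq_real]
      have hin : inner ℝ s (u - t) = inner ℝ s u - inner ℝ s t := inner_sub_right _ _ _
      have hut : ‖u - t‖ ^ 2 ≤ 2 * dist s t ^ 2 + 2 * dist s u ^ 2 := by
        have h1 : ‖u - t‖ ≤ dist s u + dist s t := by
          rw [← dist_eq_norm, dist_comm s u]; exact dist_triangle _ _ _
        have h2 := pow_le_pow_left₀ (norm_nonneg _) h1 2
        nlinarith [sq_nonneg (dist s u - dist s t)]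
      have e2 : K + n * (lam * inner ℝ s (u - t) +
          lam ^ 2 * Γ * (3 / 2 * ‖u - t‖ ^ 2 + 1 / 2 * excess μ s Γ)) =
          n / (48 * Γ) * (2 * (‖t‖ ^ 2 - ‖u‖ ^ 2 + pen t - pen u) + 4 * inner ℝ s (u - t) +
            (1 / 2 * ‖u - t‖ ^ 2 + 1 / 6 * excess μ s Γ)) := by
        simp only [hK, hlam]
        field_simp
        ring
      rw [e2]
      refine mul_le_mul_of_nonneg_left ?_ (by positivity)
      have := excess_nonneg s Γ
      linarith

/-- Exponential moments of the loss of a minimizer of the penalized contrast. -/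
lemma lintegral_exp_dist_sq_le [IsProbabilityMeasure μ] {s : Lp ℝ 2 μ} {Γ : ℝ}
    {n : ℕ} (hn : 1 ≤ n) (hΓ : 0 < Γ) (pen : Lp ℝ 2 μ → ℝ) (hs : s ∈ densitiesL2 μ)
    {S : Finset (Lp ℝ 2 μ)} (hS : (S : Set (Lp ℝ 2 μ)) ⊆ boundedDensities μ Γ)
    {est : (Fin n → X) → Lp ℝ 2 μ} (hmem : ∀ ω, est ω ∈ S)
    (hmin : ∀ ω, ∀ t ∈ S, penalizedContrast n pen ω (est ω) ≤ penalizedContrast n pen ω t)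
    {t : Lp ℝ 2 μ} (ht : t ∈ S) :
    ∫⁻ ω, ENNReal.ofReal (Real.exp (n / (96 * Γ) * dist s (est ω) ^ 2)) ∂(sampleLaw μ s n) ≤
      ENNReal.ofReal (Real.exp (n / (48 * Γ) * (3 * dist s t ^ 2 + excess μ s Γ + 2 * pen t)) *
        ∑ u ∈ S, Real.exp (-(n / (48 * Γ) * (dist s u ^ 2 / 2 + 2 * pen u)))) := by
  calc ∫⁻ ω, ENNReal.ofReal (Real.exp (n / (96 * Γ) * dist s (est ω) ^ 2)) ∂(sampleLaw μ s n)
      ≤ ∫⁻ ω, ∑ u ∈ S, ENNReal.ofReal (Real.exp (n / (96 * Γ) * dist s u ^ 2)) *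
          ENNReal.ofReal (Real.exp (n / (24 * Γ) *
            (penalizedContrast n pen ω t - penalizedContrast n pen ω u)))
          ∂(sampleLaw μ s n) := by
        refine lintegral_mono fun ω => ?_
        -- The term `u = est ω` alone suffices: minimality makes its second factor at least `1`.
        refine le_trans ?_ (Finset.single_le_sum (fun _ _ => zero_le) (hmem ω))
        refine le_mul_of_one_le_right' ?_
        rw [ENNReal.one_le_ofReal]
        refine Real.one_le_exp (mul_nonneg (by positivity) (sub_nonneg.2 (hmin ω t ht)))
    _ = ∑ u ∈ S, ENNReal.ofReal (Real.exp (n / (96 * Γ) * dist s u ^ 2)) *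
          ∫⁻ ω, ENNReal.ofReal (Real.exp (n / (24 * Γ) *
            (penalizedContrast n pen ω t - penalizedContrast n pen ω u)))
          ∂(sampleLaw μ s n) := by
        have hm : ∀ u, Measurable fun ω : Fin n → X => ENNReal.ofReal (Real.exp (n / (24 * Γ) *
            (penalizedContrast n pen ω t - penalizedContrast n pen ω u))) := fun u => by
          have h1 := measurable_penalizedContrast n pen t
          have h2 := measurable_penalizedContrast n pen u
          fun_prop
        rw [lintegral_finsetSum _ fun u _ => (hm u).const_mul _]
        exact Finset.sum_congr rfl fun u _ => lintegral_const_mul _ (hm u)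
    _ ≤ ∑ u ∈ S, ENNReal.ofReal (Real.exp (n / (96 * Γ) * dist s u ^ 2)) *
          ENNReal.ofReal (Real.exp (n / (48 * Γ) * (3 * dist s t ^ 2 + excess μ s Γ + 2 * pen t
            - dist s u ^ 2 - 2 * pen u))) := by
        gcongr with u hu
        exact lintegral_exp_penalizedContrast_sub_le hn hΓ pen hs (hS ht) (hS hu)
    _ = _ := by
        rw [Finset.mul_sum, ENNReal.ofReal_sum_of_nonneg fun u _ => by positivity]
        refine Finset.sum_congr rfl fun u _ => ?_
        rw [← ENNReal.ofReal_mul (Real.exp_pos _).le, ← Real.exp_add, ← Real.exp_add]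
        -- Half of the drift in `dist s u ^ 2` pays for the loss; the other half remains as the
        -- Gaussian weight.
        congr 2
        field_simp
        ring

end Estimator

/-! ### Gaussian sums over nets and the penalized discretization. -/

section Nets

lemma sum_exp_neg_nat_le (K : ℕ) : ∑ k ∈ Finset.range K, Real.exp (-(k : ℝ)) ≤ 2 := by
  have he : Real.exp (-1) ≤ 1 / 2 := by
    rw [Real.exp_neg, inv_le_comm₀ (Real.exp_pos 1) (by norm_num)]
    linarith [Real.add_one_le_exp (1 : ℝ)]
  calc ∑ k ∈ Finset.range K, Real.exp (-(k : ℝ))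
      ≤ ∑ k ∈ Finset.range K, (1 / 2 : ℝ) ^ k := by
        refine Finset.sum_le_sum fun k _ => ?_
        have : Real.exp (-(k : ℝ)) = Real.exp (-1) ^ k := by
          rw [← Real.exp_nat_mul]; congr 1; ring
        rw [this]
        exact pow_le_pow_left₀ (Real.exp_pos _).le he k
    _ ≤ 2 := sum_geometric_two_le K

/-- Gaussian sums over a net whose balls have a controlled cardinality. -/
lemma sum_exp_neg_dist_sq_le {M : Type*} [MetricSpace M] {N : Set M} {D η b B : ℝ}
    (hη : 0 < η) (hB : 1 / 2 ≤ B) (hDB : D ≤ B) (hb : 4 * B ≤ b * η ^ 2)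
    (hN : ∀ x : ℝ, 2 ≤ x → ∀ t : M, (N ∩ Metric.ball t (x * η)).Finite ∧
      ((N ∩ Metric.ball t (x * η)).ncard : ℝ) ≤ Real.exp (D * x ^ 2))
    {F : Finset M} (hF : (F : Set M) ⊆ N) (s : M) :
    ∑ t ∈ F, Real.exp (-(b * dist s t ^ 2)) ≤ 2 * Real.exp (8 * B) := by
  classical
  have hb0 : 0 ≤ b := by
    by_contra h
    have := sq_nonneg η
    nlinarith
  -- The net is sliced into shells of width `η` around `s`.
  set idx : M → ℕ := fun t => ⌊dist s t / η⌋₊ with hidx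
  set K := F.sup idx + 1
  have hmaps : ∀ t ∈ F, idx t ∈ Finset.range K := fun t ht =>
    Finset.mem_range.2 (Nat.lt_succ_of_le (Finset.le_sup ht))
  rw [← Finset.sum_fiberwise_of_maps_to hmaps]
  calc ∑ k ∈ Finset.range K, ∑ t ∈ F with idx t = k, Real.exp (-(b * dist s t ^ 2))
      ≤ ∑ k ∈ Finset.range K, Real.exp (8 * B) * Real.exp (-(k : ℝ)) := by
        refine Finset.sum_le_sum fun k _ => ?_
        have hterm : ∀ t ∈ F.filter (fun t => idx t = k),
            Real.exp (-(b * dist s t ^ 2)) ≤ Real.exp (-(4 * B * k ^ 2)) := by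
          intro t ht
          rw [Finset.mem_filter] at ht
          have h1 : (k : ℝ) ≤ dist s t / η := by
            rw [← ht.2]; exact Nat.floor_le (by positivity)
          rw [le_div_iff₀ hη] at h1
          have h2 := pow_le_pow_left₀ (by positivity) h1 2
          rw [Real.exp_le_exp, neg_le_neg_iff]
          calc 4 * B * k ^ 2 ≤ b * η ^ 2 * k ^ 2 := by gcongr
            _ = b * (k * η) ^ 2 := by ring
            _ ≤ b * dist s t ^ 2 := by gcongr
        have hcard : ((F.filter (fun t => idx t = k)).card : ℝ) ≤
            Real.exp (D * ((k : ℝ) + 2) ^ 2) := by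
          -- Radius `k + 1` would contain the shell; `k + 2` also meets the requirement `2 ≤ x` when
          -- `k = 0`.
          obtain ⟨hfin, hle⟩ := hN ((k : ℝ) + 2) (by linarith [(Nat.cast_nonneg k : (0 : ℝ) ≤ k)]) s
          refine le_trans ?_ hle
          rw [← Set.ncard_coe_finset]
          refine Nat.cast_le.2 (Set.ncard_le_ncard (fun t ht => ?_) hfin)
          rw [Finset.mem_coe, Finset.mem_filter] at ht
          refine ⟨hF ht.1, ?_⟩
          have h1 := Nat.lt_floor_add_one (dist s t / η)
          have h2 : (⌊dist s t / η⌋₊ : ℝ) = k := by exact_mod_cast ht.2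
          rw [h2, div_lt_iff₀ hη] at h1
          rw [Metric.mem_ball, dist_comm]
          nlinarith
        calc ∑ t ∈ F with idx t = k, Real.exp (-(b * dist s t ^ 2))
            ≤ (F.filter (fun t => idx t = k)).card • Real.exp (-(4 * B * k ^ 2)) :=
              Finset.sum_le_card_nsmul _ _ _ hterm
          _ ≤ Real.exp (D * ((k : ℝ) + 2) ^ 2) * Real.exp (-(4 * B * k ^ 2)) := by
              rw [nsmul_eq_mul]; gcongr
          _ ≤ Real.exp (8 * B) * Real.exp (-(k : ℝ)) := by
              rw [← Real.exp_add, ← Real.exp_add, Real.exp_le_exp]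
              -- Since `(k + 2)² ≤ 2k² + 8`, the decay `4Bk²` leaves `2Bk² ≥ k² ≥ k` to spare, and
              -- the `8` gives the factor `exp (8 * B)`.
              have h1 : D * ((k : ℝ) + 2) ^ 2 ≤ B * ((k : ℝ) + 2) ^ 2 := by gcongr
              have h2 : B * ((k : ℝ) + 2) ^ 2 ≤ B * (2 * (k : ℝ) ^ 2 + 8) := by
                refine mul_le_mul_of_nonneg_left ?_ (by linarith)
                nlinarith [sq_nonneg ((k : ℝ) - 2)]
              have h3 : (k : ℝ) ≤ (k : ℝ) ^ 2 := by
                exact_mod_cast Nat.le_self_pow (by norm_num) k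
              have h4 : (k : ℝ) ^ 2 ≤ 2 * B * (k : ℝ) ^ 2 :=
                le_mul_of_one_le_left (sq_nonneg _) (by linarith)
              linarith
    _ ≤ 2 * Real.exp (8 * B) := by
        rw [← Finset.mul_sum, mul_comm]
        exact mul_le_mul_of_nonneg_right (sum_exp_neg_nat_le K) (Real.exp_pos _).le

/-- A weight on a finite index set descends to the image of the index set. -/
lemma exists_image_weight {J M : Type*} [Nonempty J] [DecidableEq M] (T : Finset J) (π : J → M)
    (p : J → ℝ) : ∃ pen : M → ℝ, (∀ j ∈ T, pen (π j) ≤ p j) ∧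
      ∀ g : M → ℝ → ℝ, (∀ u v, 0 ≤ g u v) →
        ∑ u ∈ T.image π, g u (pen u) ≤ ∑ j ∈ T, g (π j) (p j) := by
  classical
  -- Several indices may share an image; the cheapest one represents it.
  have hex : ∀ u ∈ T.image π, ∃ j : J, j ∈ T ∧ π j = u ∧ ∀ j' ∈ T, π j' = u → p j ≤ p j' := by
    intro u hu
    obtain ⟨j₀, hj₀, rfl⟩ := Finset.mem_image.1 hu
    obtain ⟨j, hj, hmin⟩ := Finset.exists_min_image (T.filter fun j => π j = π j₀) p
      ⟨j₀, Finset.mem_filter.2 ⟨hj₀, rfl⟩⟩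
    rw [Finset.mem_filter] at hj
    exact ⟨j, hj.1, hj.2, fun j' h1 h2 => hmin j' (Finset.mem_filter.2 ⟨h1, h2⟩)⟩
  choose! σ hσT hσ hσmin using hex
  refine ⟨fun u => p (σ u), fun j hj => hσmin _ (Finset.mem_image_of_mem π hj) j hj rfl, ?_⟩
  intro g hg
  calc ∑ u ∈ T.image π, g u (p (σ u))
      = ∑ u ∈ T.image π, g (π (σ u)) (p (σ u)) :=
        Finset.sum_congr rfl fun u hu => by rw [hσ u hu]
    _ = ∑ j ∈ Finset.image σ (T.image π), g (π j) (p j) := by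
        have hinj : InjOn σ (T.image π : Finset M) := fun u hu v hv h => by
          rw [← hσ u hu, ← hσ v hv, h]
        rw [Finset.sum_image hinj]
    _ ≤ ∑ j ∈ T, g (π j) (p j) :=
        Finset.sum_le_sum_of_subset_of_nonneg
          (Finset.image_subset_iff.2 fun u hu => hσT u hu) fun _ _ _ => hg _ _

/-- The terms of a summable family tend to `0` along the cofinite filter. -/
lemma finite_setOf_le_of_summable_exp_neg {ι : Type*} {Δ : ι → ℝ}
    (h : Summable fun m => Real.exp (-Δ m)) (c : ℝ) : {m | Δ m ≤ c}.Finite := by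
  have h1 := h.tendsto_cofinite_zero.eventually (gt_mem_nhds (Real.exp_pos (-c)))
  refine (Filter.eventually_cofinite.1 h1).subset fun m hm => ?_
  simpa using hm

variable {X : Type*} [MeasurableSpace X] {μ : Measure X}

lemma exists_mem_boundedDensities [IsProbabilityMeasure μ] {Γ : ℝ} (hΓ : 1 ≤ Γ) :
    ∃ t, t ∈ boundedDensities μ Γ := by
  have hL : MemLp (fun _ : X => (1 : ℝ)) 2 μ := memLp_const 1
  have hco := hL.coeFn_toLp
  refine ⟨hL.toLp _, ⟨?_, ?_⟩, eLpNorm_top_le_of_ae_le ?_⟩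
  · filter_upwards [hco] with x hx
    rw [hx]; norm_num
  · rw [integral_congr_ae hco]; simp
  · filter_upwards [hco] with x hx
    rw [hx]; simpa using hΓ

/-- A finite set of bounded densities and a penalty, with a controlled total weight, that
approximate every density nearly as well as each of the models does. -/
lemma exists_penalized_net [IsProbabilityMeasure μ] {n : ℕ} (hn : 1 ≤ n) {ι : Type*}
    {model : ι → Set (Lp ℝ 2 μ)} {D Δ : ι → ℝ} {Sig : ℝ} (hne : ∀ m, (model m).Nonempty)
    (hD : ∀ m, 1 / 2 ≤ D m) (hdim : ∀ m, HasMetricDimLE (model m) (D m))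
    (hsum : HasSum (fun m => Real.exp (-Δ m)) Sig) (hSig : 1 ≤ Sig) {Γ : ℝ} (hΓ : 3 ≤ Γ) :
    ∃ (S : Finset (Lp ℝ 2 μ)) (pen : Lp ℝ 2 μ → ℝ), S.Nonempty ∧
      (S : Set (Lp ℝ 2 μ)) ⊆ boundedDensities μ Γ ∧
      (∀ s, ∑ u ∈ S, Real.exp (-(n / (48 * Γ) * (dist s u ^ 2 / 2 + 2 * pen u))) ≤ 3 * Sig) ∧
      ∀ s ∈ densitiesL2 μ, ∀ m, ∀ y, y = Metric.infDist s (model m) +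
          Real.sqrt (Γ * max (D m) (Δ m) / n) + Real.sqrt (excess μ s Γ) →
        Real.sqrt Γ ≤ 15 * y ∨
          ∃ t ∈ S, 3 * dist s t ^ 2 + excess μ s Γ + 2 * pen t ≤ (110 * y) ^ 2 := by
  classical
  have hn0 : (0 : ℝ) < n := by exact_mod_cast hn
  have hΓ0 : 0 < Γ := by linarith
  set B : ι → ℝ := fun m => max (D m) (Δ m) with hBdef
  have hB : ∀ m, 1 / 2 ≤ B m := fun m => (hD m).trans (le_max_left _ _)
  set τ : ι → ℝ := fun m => Real.sqrt (Γ * B m / n) with hτdef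
  have hτsq : ∀ m, τ m ^ 2 = Γ * B m / n := fun m =>
    Real.sq_sqrt (by have := hB m; positivity)
  have hτ : ∀ m, 0 < τ m := fun m => Real.sqrt_pos.2 (by have := hB m; positivity)
  obtain ⟨o, ho⟩ := exists_mem_boundedDensities (μ := μ) (Γ := Γ) (by linarith)
  -- The factor `28` satisfies `28² / 192 ≥ 4`, as the Gaussian sum with `b = n / (192 * Γ)`
  -- requires.
  choose N hcov hcount using fun m => hdim m (28 * τ m) (by have := hτ m; positivity)
  -- A projection up to `τ m` suffices, so no attained infimum is needed.
  have hproj : ∀ m (t : Lp ℝ 2 μ), ∃ r ∈ boundedDensities μ Γ,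
      dist t r < Metric.infDist t (boundedDensities μ Γ) + τ m := fun m t =>
    (Metric.infDist_lt_iff ⟨o, ho⟩).1 (by linarith [hτ m])
  choose proj hprojmem hprojdist using hproj
  have hfinB : {m | B m ≤ n}.Finite :=
    (finite_setOf_le_of_summable_exp_neg hsum.summable n).subset
      fun m (hm : B m ≤ n) => show Δ m ≤ n from (le_max_right _ _).trans hm
  set ρ : ι → ℝ := fun m => 2 + 4 * Real.sqrt Γ / (28 * τ m)
  have hρ : ∀ m, 2 ≤ ρ m := fun m => by
    have := hτ m
    have : 0 ≤ 4 * Real.sqrt Γ / (28 * τ m) := by positivity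
    simp only [ρ]; linarith
  have hfinN : ∀ m, (N m ∩ Metric.ball o (ρ m * (28 * τ m))).Finite := fun m =>
    (hcount m (ρ m) (hρ m) o).1
  -- The index `none` stands for the density `o` with penalty `0`; it keeps the set nonempty and
  -- adds at most `1 ≤ Sig` to the total weight.
  set T : Finset (Option (Σ _ : ι, Lp ℝ 2 μ)) :=
    Finset.insertNone (hfinB.toFinset.sigma fun m => (hfinN m).toFinset) with hT
  set π : Option (Σ _ : ι, Lp ℝ 2 μ) → Lp ℝ 2 μ := fun j => j.elim o fun i => proj i.1 i.2
  -- The term `216 τ²` produces `exp (-9B)`, which beats the Gaussian sum `2 exp (8B)` and leaves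
  -- `exp (-B) ≤ exp (-Δ)`. The squared displacement lets distances to projected points be replaced
  -- by distances to the net points themselves.
  set p : Option (Σ _ : ι, Lp ℝ 2 μ) → ℝ := fun j => j.elim 0 fun i =>
    216 * τ i.1 ^ 2 + dist i.2 (proj i.1 i.2) ^ 2 / 4
  obtain ⟨pen, hpen, hpensum⟩ := exists_image_weight T π p
  have hπmem : ∀ j, π j ∈ boundedDensities μ Γ := by
    rintro (_ | i)
    · exact ho
    · exact hprojmem _ _
  refine ⟨T.image π, pen, ⟨o, Finset.mem_image.2 ⟨none, by simp [hT], rfl⟩⟩, ?_, ?_, ?_⟩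
  · intro u hu
    obtain ⟨j, -, rfl⟩ := Finset.mem_image.1 (Finset.mem_coe.1 hu)
    exact hπmem j
  · intro s
    refine (hpensum (fun u v => Real.exp (-(n / (48 * Γ) * (dist s u ^ 2 / 2 + 2 * v))))
      fun _ _ => (Real.exp_pos _).le).trans ?_
    rw [hT, Finset.sum_insertNone, Finset.sum_sigma]
    have h0 : Real.exp (-(n / (48 * Γ) * (dist s (π none) ^ 2 / 2 + 2 * p none))) ≤ 1 := by
      rw [Real.exp_le_one_iff, neg_nonpos]
      simp only [p, Option.elim_none]
      positivity
    have hm : ∀ m ∈ hfinB.toFinset, ∑ t ∈ (hfinN m).toFinset,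
        Real.exp (-(n / (48 * Γ) * (dist s (π (some ⟨m, t⟩)) ^ 2 / 2 + 2 * p (some ⟨m, t⟩)))) ≤
        2 * Real.exp (-Δ m) := by
      intro m _
      have hF : (((hfinN m).toFinset : Finset (Lp ℝ 2 μ)) : Set (Lp ℝ 2 μ)) ⊆ N m := by
        intro t ht
        simp only [Finite.coe_toFinset] at ht
        exact ht.1
      have hshell := sum_exp_neg_dist_sq_le (b := n / (192 * Γ)) (B := B m)
        (by have := hτ m; positivity : 0 < 28 * τ m) (hB m) (le_max_left _ _)
        (by
          rw [mul_pow, hτsq]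
          have := hB m
          field_simp
          norm_num) (hcount m) hF s
      calc _ ≤ ∑ t ∈ (hfinN m).toFinset, Real.exp (-(9 * B m)) *
            Real.exp (-(n / (192 * Γ) * dist s t ^ 2)) := by
            refine Finset.sum_le_sum fun t _ => ?_
            rw [← Real.exp_add, Real.exp_le_exp]
            simp only [π, p, Option.elim_some]
            set r := proj m t
            have h1 : dist s t ^ 2 ≤ 2 * dist s r ^ 2 + 2 * dist t r ^ 2 := by
              have := pow_le_pow_left₀ dist_nonneg (dist_triangle_right s t r) 2
              nlinarith [sq_nonneg (dist s r - dist t r)]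
            have h2 : n / (48 * Γ) * (2 * (216 * τ m ^ 2)) = 9 * B m := by
              rw [hτsq]; field_simp; ring
            have h3 : n / (192 * Γ) * dist s t ^ 2 ≤
                n / (192 * Γ) * (2 * dist s r ^ 2 + 2 * dist t r ^ 2) := by gcongr
            have h4 : (n : ℝ) / (48 * Γ) = 4 * (n / (192 * Γ)) := by field_simp; norm_num
            rw [h4] at h2 ⊢
            linarith
        _ ≤ Real.exp (-(9 * B m)) * (2 * Real.exp (8 * B m)) := by
            rw [← Finset.mul_sum]; gcongr
        _ = 2 * Real.exp (-B m) := by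
            rw [mul_left_comm, ← Real.exp_add]; congr 2; ring
        _ ≤ 2 * Real.exp (-Δ m) := by
            have := le_max_right (D m) (Δ m)
            gcongr
    have hS : ∑ m ∈ hfinB.toFinset, 2 * Real.exp (-Δ m) ≤ 2 * Sig := by
      rw [← Finset.mul_sum]
      have := sum_le_hasSum hfinB.toFinset (fun m _ => (Real.exp_pos (-Δ m)).le) hsum
      linarith
    have := Finset.sum_le_sum hm
    linarith
  · intro s hs m y hy
    set R := Real.sqrt (excess μ s Γ)
    have hR : 0 ≤ R := Real.sqrt_nonneg _
    have hRsq : R ^ 2 = excess μ s Γ := Real.sq_sqrt (excess_nonneg s Γ)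
    have hbnn : 0 ≤ Metric.infDist s (model m) := Metric.infDist_nonneg
    have hτm := hτ m
    change y = Metric.infDist s (model m) + τ m + R at hy
    set β := Metric.infDist s (model m)
    have hsqΓ := Real.sqrt_pos.2 hΓ0
    -- A discarded model has `τ m ≥ √Γ`, hence a trivial bound.
    by_cases hBn : B m ≤ n
    swap
    · left
      have : Real.sqrt Γ ≤ τ m := by
        refine Real.sqrt_le_sqrt ?_
        rw [le_div_iff₀ hn0]
        exact mul_le_mul_of_nonneg_left (not_le.1 hBn).le hΓ0.le
      linarith
    obtain ⟨r, hr, hsr⟩ := exists_mem_boundedDensities_dist_le hΓ hs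
    obtain ⟨t₀, ht₀, hst₀⟩ := (Metric.infDist_lt_iff (hne m)).1
      (show Metric.infDist s (model m) < β + τ m by linarith)
    obtain ⟨t, htN, htt⟩ := hcov m t₀ ht₀
    have hst : dist s t ≤ β + 29 * τ m := by linarith [dist_triangle s t₀ t]
    have htr : dist t r ≤ β + 29 * τ m + 3 * R := by
      linarith [dist_triangle_left t r s]
    -- A net point this far from `o` is at least `2√Γ` from the bounded density `r`, although `dist
    -- t r ≤ 29 * y`.
    by_cases hball : dist t o < 4 * Real.sqrt Γ
    swap
    · left
      have := dist_le_of_mem_boundedDensities hΓ0.le hr ho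
      linarith [dist_triangle t r o]
    right
    have hρm : 4 * Real.sqrt Γ ≤ ρ m * (28 * τ m) := by
      have h : 4 * Real.sqrt Γ / (28 * τ m) * (28 * τ m) = 4 * Real.sqrt Γ :=
        div_mul_cancel₀ _ (by positivity)
      simp only [ρ, add_mul, h]
      linarith
    have hmemT : some (⟨m, t⟩ : Σ _ : ι, Lp ℝ 2 μ) ∈ T := by
      simp only [hT, Finset.some_mem_insertNone, Finset.mem_sigma, Finite.mem_toFinset]
      exact ⟨hBn, htN, Metric.mem_ball.2 (hball.trans_le hρm)⟩
    refine ⟨proj m t, Finset.mem_image.2 ⟨_, hmemT, rfl⟩, ?_⟩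
    have hp := hpen _ hmemT
    simp only [π, p, Option.elim_some] at hp
    have htp : dist t (proj m t) ≤ 30 * y := by
      have h1 := hprojdist m t
      have h2 := Metric.infDist_le_dist_of_mem (x := t) hr
      linarith
    have hsp : dist s (proj m t) ≤ 59 * y := by
      have h1 := hprojdist m t
      have h2 := Metric.infDist_le_dist_of_mem (x := t) hr
      linarith [dist_triangle s t (proj m t)]
    have hτy : τ m ^ 2 ≤ y ^ 2 := pow_le_pow_left₀ hτm.le (by linarith) 2
    have hRy : R ^ 2 ≤ y ^ 2 := pow_le_pow_left₀ hR (by linarith) 2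
    have h1 := pow_le_pow_left₀ dist_nonneg htp 2
    have h2 := pow_le_pow_left₀ dist_nonneg hsp 2
    rw [← hRsq]
    -- The total is `3 * 59² + 1 + 2 * (216 + 30² / 4) = 11326 ≤ 110²`.
    nlinarith [sq_nonneg y]

end Nets

/-! ### From exponential moments to risk bounds. -/

/-- A power is dominated by a Gaussian exponential. -/
lemma rpow_le_mul_one_add_exp {d Y a b q : ℝ} (hd : 0 ≤ d) (hY : 0 < Y) (hq : 0 ≤ q)
    (ha : 1 ≤ a * Y ^ 2) (hb : b ≤ Y ^ 2) :
    d ^ q ≤ (2 ^ q + Real.exp (q ^ 2)) * Y ^ q * (1 + Real.exp (a / 2 * d ^ 2 - a * b)) := by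
  have hY2 : 0 < Y ^ 2 := by positivity
  have ha0 : 0 ≤ a := by
    by_contra h
    nlinarith
  have hE := Real.exp_pos (a / 2 * d ^ 2 - a * b)
  have hYq : 0 < Y ^ q := Real.rpow_pos_of_pos hY q
  have h2q : (0 : ℝ) < 2 ^ q := Real.rpow_pos_of_pos (by norm_num) q
  have hEq := Real.exp_pos (q ^ 2)
  rcases le_or_gt d (2 * Y) with h | h
  · calc d ^ q ≤ (2 * Y) ^ q := Real.rpow_le_rpow hd h hq
      _ = 2 ^ q * Y ^ q * 1 := by rw [Real.mul_rpow (by norm_num) hY.le, mul_one]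
      _ ≤ _ := by gcongr <;> linarith
  · set x := d / Y with hx
    have hdx : d = x * Y := by rw [hx]; field_simp
    have hx0 : 0 < x := by
      rw [hx]; exact div_pos (by linarith) hY
    have hx2 : 2 ≤ x := by rw [hx, le_div_iff₀ hY]; exact h.le
    -- Beyond `2 * Y`, `a * b ≤ a * d² / 4`, so the exponent is at least `x² / 4`, while `x ^ q ≤
    -- exp (q * x) ≤ exp (q² + x² / 4)`.
    have h1 : x ^ q ≤ Real.exp (q ^ 2) * Real.exp (a / 2 * d ^ 2 - a * b) := by
      rw [← Real.exp_add, Real.rpow_def_of_pos hx0, Real.exp_le_exp]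
      have h3 : Real.log x ≤ x := (Real.log_le_sub_one_of_pos hx0).trans (by linarith)
      have h4 : Real.log x * q ≤ x * q := mul_le_mul_of_nonneg_right h3 hq
      have h5 : x * q ≤ q ^ 2 + x ^ 2 / 4 := by nlinarith [sq_nonneg (q - x / 2)]
      have h6 : x ^ 2 / 4 ≤ a * Y ^ 2 * (x ^ 2 / 4) :=
        le_mul_of_one_le_left (by positivity) ha
      have h7 : a * b ≤ a * Y ^ 2 := by gcongr
      have h8 : a * Y ^ 2 * 4 ≤ a * Y ^ 2 * x ^ 2 := by
        refine mul_le_mul_of_nonneg_left ?_ (by positivity)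
        nlinarith
      have h9 : a / 2 * d ^ 2 = a * Y ^ 2 * x ^ 2 / 2 := by rw [hdx]; ring
      rw [h9]
      linarith
    calc d ^ q = Y ^ q * x ^ q := by rw [hdx, Real.mul_rpow hx0.le hY.le, mul_comm]
      _ ≤ Y ^ q * (Real.exp (q ^ 2) * Real.exp (a / 2 * d ^ 2 - a * b)) := by gcongr
      _ = Real.exp (q ^ 2) * Y ^ q * Real.exp (a / 2 * d ^ 2 - a * b) := by ring
      _ ≤ _ := by gcongr <;> linarith

/-- The infimum need not be attained: monotonicity gives the bound at the infimum plus any `ε > 0`,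
and continuity lets `ε` tend to `0`. -/
lemma le_ofReal_of_forall_le_of_iInf {ι : Type*} [Nonempty ι] {f : ι → ℝ} {φ : ℝ → ℝ} {r : ℝ≥0∞}
    (hf : BddBelow (range f)) (hφ : Continuous φ) (hmono : MonotoneOn φ (Ici (⨅ m, f m)))
    (h : ∀ m, r ≤ ENNReal.ofReal (φ (f m))) : r ≤ ENNReal.ofReal (φ (⨅ m, f m)) := by
  have hlim : Filter.Tendsto (fun ε : ℝ => ENNReal.ofReal (φ ((⨅ m, f m) + ε)))
      (nhdsWithin 0 (Ioi 0)) (nhds (ENNReal.ofReal (φ (⨅ m, f m)))) := by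
    have hc : Continuous fun ε : ℝ => ENNReal.ofReal (φ ((⨅ m, f m) + ε)) :=
      ENNReal.continuous_ofReal.comp (by fun_prop)
    have := (hc.tendsto 0).mono_left (nhdsWithin_le_nhds (s := Ioi 0))
    simpa using this
  refine ge_of_tendsto hlim ?_
  filter_upwards [self_mem_nhdsWithin] with ε hε
  have hε' : (0 : ℝ) < ε := hε
  obtain ⟨m, hm⟩ := exists_lt_of_ciInf_lt (show (⨅ m, f m) < (⨅ m, f m) + ε by linarith)
  refine (h m).trans (ENNReal.ofReal_le_ofReal (hmono ?_ ?_ hm.le))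
  · exact ciInf_le hf m
  · exact (by linarith : (⨅ m, f m) ≤ (⨅ m, f m) + ε)

/-- The constant of the risk bound for the `q`-th power of the loss. -/
noncomputable def riskConst (q : ℝ) : ℝ := 4 * (2 ^ q + Real.exp (q ^ 2)) * 110 ^ q

lemma riskConst_pos (q : ℝ) : 0 < riskConst q := by
  unfold riskConst
  positivity

/-- A risk bound for penalized estimators in terms of the error bound of one model. -/
lemma risk_le_of_exponential_moment {X : Type*} [MeasurableSpace X] {μ : Measure X}
    [IsProbabilityMeasure μ] {s : Lp ℝ 2 μ} (hs : s ∈ densitiesL2 μ) {n : ℕ}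
    {est : (Fin n → X) → Lp ℝ 2 μ} {a b Y Sig q : ℝ} (hY : 0 < Y) (hq : 0 ≤ q)
    (hSig : 1 ≤ Sig) (ha : 1 ≤ a * Y ^ 2) (hb : b ≤ Y ^ 2)
    (h : ∫⁻ ω, ENNReal.ofReal (Real.exp (a / 2 * dist s (est ω) ^ 2)) ∂(sampleLaw μ s n) ≤
      ENNReal.ofReal (Real.exp (a * b) * (3 * Sig))) :
    risk μ s n q est ≤ ENNReal.ofReal (4 * (2 ^ q + Real.exp (q ^ 2)) * Sig * Y ^ q) := by
  have := isProbabilityMeasure_sampleLaw hs n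
  have hYq : 0 < Y ^ q := Real.rpow_pos_of_pos hY q
  have h2q : (0 : ℝ) < 2 ^ q := Real.rpow_pos_of_pos (by norm_num) q
  set A := (2 ^ q + Real.exp (q ^ 2)) * Y ^ q with hA
  have hA0 : 0 < A := by positivity
  calc risk μ s n q est
      ≤ ∫⁻ ω, (ENNReal.ofReal A + ENNReal.ofReal (A * Real.exp (-(a * b))) *
          ENNReal.ofReal (Real.exp (a / 2 * dist s (est ω) ^ 2))) ∂(sampleLaw μ s n) := by
        refine lintegral_mono fun ω => ?_
        rw [edist_dist, ENNReal.ofReal_rpow_of_nonneg dist_nonneg hq,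
          ← ENNReal.ofReal_mul (by positivity), ← ENNReal.ofReal_add hA0.le (by positivity)]
        refine ENNReal.ofReal_le_ofReal
          ((rpow_le_mul_one_add_exp dist_nonneg hY hq ha hb).trans_eq ?_)
        rw [mul_assoc A, ← Real.exp_add, neg_add_eq_sub]
        ring
    _ = ENNReal.ofReal A + ENNReal.ofReal (A * Real.exp (-(a * b))) *
          ∫⁻ ω, ENNReal.ofReal (Real.exp (a / 2 * dist s (est ω) ^ 2)) ∂(sampleLaw μ s n) := by
        rw [lintegral_add_left measurable_const, lintegral_const, measure_univ, mul_one,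
          lintegral_const_mul' _ _ ENNReal.ofReal_ne_top]
    _ ≤ ENNReal.ofReal A + ENNReal.ofReal (A * Real.exp (-(a * b))) *
          ENNReal.ofReal (Real.exp (a * b) * (3 * Sig)) := by gcongr
    _ = ENNReal.ofReal (A + A * (3 * Sig)) := by
        rw [← ENNReal.ofReal_mul (by positivity), ← ENNReal.ofReal_add hA0.le (by positivity)]
        congr 2
        rw [Real.exp_neg]
        field_simp
    _ ≤ _ := by
        refine ENNReal.ofReal_le_ofReal ?_
        have : A ≤ A * Sig := le_mul_of_one_le_right hA0.le hSig
        calc A + A * (3 * Sig) ≤ 4 * (A * Sig) := by linarith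
          _ = _ := by rw [hA]; ring

lemma risk_le_of_dist_le {X : Type*} [MeasurableSpace X] {μ : Measure X}
    [IsProbabilityMeasure μ] {s : Lp ℝ 2 μ} (hs : s ∈ densitiesL2 μ) {n : ℕ}
    {est : (Fin n → X) → Lp ℝ 2 μ} {Y q : ℝ} (hq : 0 ≤ q) (h : ∀ ω, dist s (est ω) ≤ Y) :
    risk μ s n q est ≤ ENNReal.ofReal (Y ^ q) := by
  have := isProbabilityMeasure_sampleLaw hs n
  calc risk μ s n q est ≤ ∫⁻ _, ENNReal.ofReal (Y ^ q) ∂(sampleLaw μ s n) := by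
        refine lintegral_mono fun ω => ?_
        rw [edist_dist, ENNReal.ofReal_rpow_of_nonneg dist_nonneg hq]
        exact ENNReal.ofReal_le_ofReal (Real.rpow_le_rpow dist_nonneg (h ω) hq)
    _ = _ := by rw [lintegral_const, measure_univ, mul_one]

/-- Existence of a T-estimator whose risk is controlled by each of the models. -/
lemma exists_isTEstimator_risk_le {X : Type*} [MeasurableSpace X] {μ : Measure X}
    [IsProbabilityMeasure μ] {n : ℕ} (hn : 1 ≤ n) {ι : Type*}
    {model : ι → Set (Lp ℝ 2 μ)} {D Δ : ι → ℝ} {Sig : ℝ} (hne : ∀ m, (model m).Nonempty)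
    (hD : ∀ m, 1 / 2 ≤ D m) (hdim : ∀ m, HasMetricDimLE (model m) (D m))
    (hsum : HasSum (fun m => Real.exp (-Δ m)) Sig) (hSig : 1 ≤ Sig) {Γ : ℝ} (hΓ : 3 ≤ Γ) :
    ∃ (S : Set (Lp ℝ 2 μ)) (ψ : Lp ℝ 2 μ → Lp ℝ 2 μ → (Fin n → X) → Lp ℝ 2 μ)
      (est : (Fin n → X) → Lp ℝ 2 μ), S ⊆ boundedDensities μ Γ ∧ IsTEstimator S ψ est ∧
      ∀ s ∈ densitiesL2 μ, ∀ q : ℝ, 0 ≤ q → ∀ m,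
        risk μ s n q est ≤ ENNReal.ofReal (riskConst q * Sig *
          (Metric.infDist s (model m) + Real.sqrt (Γ * max (D m) (Δ m) / n)
            + Real.sqrt (excess μ s Γ)) ^ q) := by
  have hn0 : (0 : ℝ) < n := by exact_mod_cast hn
  have hΓ0 : 0 < Γ := by linarith
  obtain ⟨S, pen, hSne, hSb, hweight, happrox⟩ :=
    exists_penalized_net hn hne hD hdim hsum hSig hΓ
  obtain ⟨ψ, est, hT, hmin⟩ := exists_isTEstimator_of_criterion hSne
    (c := fun (ω : Fin n → X) t => penalizedContrast n pen ω t)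
    fun t => measurable_penalizedContrast n pen t
  refine ⟨S, ψ, est, hSb, hT, fun s hs q hq m => ?_⟩
  have hestS : ∀ ω, est ω ∈ S := hT.mem
  set τ := Real.sqrt (Γ * max (D m) (Δ m) / n) with hτdef
  set R := Real.sqrt (excess μ s Γ)
  set y := Metric.infDist s (model m) + τ + R with hy
  have hB : 1 / 2 ≤ max (D m) (Δ m) := (hD m).trans (le_max_left _ _)
  have hτsq : τ ^ 2 = Γ * max (D m) (Δ m) / n := Real.sq_sqrt (by positivity)
  have hτ : 0 < τ := Real.sqrt_pos.2 (by positivity)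
  have hR : 0 ≤ R := Real.sqrt_nonneg _
  have hi : 0 ≤ Metric.infDist s (model m) := Metric.infDist_nonneg
  have hy0 : 0 < y := by positivity
  have hconst : 4 * (2 ^ q + Real.exp (q ^ 2)) * Sig * (110 * y) ^ q =
      riskConst q * Sig * y ^ q := by
    rw [Real.mul_rpow (by norm_num) hy0.le, riskConst]; ring
  rw [← hconst]
  rcases happrox s hs m y rfl with h | ⟨t, ht, hb⟩
  -- In the trivial case every value of the estimator is within `3R + 2√Γ ≤ 33 * y` of `s`.
  · refine (risk_le_of_dist_le hs hq (Y := 110 * y) fun ω => ?_).trans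
      (ENNReal.ofReal_le_ofReal ?_)
    · obtain ⟨r, hr, hsr⟩ := exists_mem_boundedDensities_dist_le hΓ hs
      have h1 := dist_le_of_mem_boundedDensities hΓ0.le hr (hSb (hestS ω))
      linarith [dist_triangle s r (est ω)]
    · refine le_mul_of_one_le_left (by positivity) ?_
      have h1 : 1 ≤ Real.exp (q ^ 2) := Real.one_le_exp (sq_nonneg q)
      have h2 : (0 : ℝ) < 2 ^ q := Real.rpow_pos_of_pos (by norm_num) q
      nlinarith
  · refine risk_le_of_exponential_moment hs (a := n / (48 * Γ))
      (b := 3 * dist s t ^ 2 + excess μ s Γ + 2 * pen t) (by positivity) hq hSig ?_ hb ?_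
    · have h1 : τ ^ 2 ≤ y ^ 2 := pow_le_pow_left₀ hτ.le (by linarith) 2
      -- The lower bound `1/2` on the dimension keeps `y` above the statistical scale `√(Γ / n)`, up
      -- to a constant.
      have h2 : 1 ≤ n / (48 * Γ) * (12100 * τ ^ 2) := by
        rw [hτsq]
        have : n / (48 * Γ) * (12100 * (Γ * max (D m) (Δ m) / n)) =
            12100 / 48 * max (D m) (Δ m) := by field_simp
        rw [this]
        linarith
      refine h2.trans (mul_le_mul_of_nonneg_left ?_ (by positivity))
      nlinarith
    · have h1 := lintegral_exp_dist_sq_le hn hΓ0 pen hs hSb hestS hmin ht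
      have h2 : (n : ℝ) / (96 * Γ) = n / (48 * Γ) / 2 := by field_simp; norm_num
      rw [h2] at h1
      refine h1.trans (ENNReal.ofReal_le_ofReal ?_)
      exact mul_le_mul_of_nonneg_left (hweight s) (Real.exp_pos _).le

theorem mainTheorem2 :
    ∃ (C : ℝ → ℝ) (C' : ℝ),
      ∀ (X : Type*) [MeasurableSpace X] (μ : Measure X) [IsProbabilityMeasure μ]
        (n : ℕ) (_ : 1 ≤ n)
        (ι : Type*) [Countable ι] (model : ι → Set (Lp ℝ 2 μ)) (D Δ : ι → ℝ) (Sig : ℝ)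
        (_ : ∀ m, (model m).Nonempty) (_ : ∀ m, 1 / 2 ≤ D m)
        (_ : ∀ m, HasMetricDimLE (model m) (D m))
        (_ : HasSum (fun m => Real.exp (-Δ m)) Sig) (_ : 1 ≤ Sig)
        (Γ : ℝ) (_ : 3 ≤ Γ),
        ∃ (S : Set (Lp ℝ 2 μ)) (ψ : Lp ℝ 2 μ → Lp ℝ 2 μ → (Fin n → X) → Lp ℝ 2 μ)
          (est : (Fin n → X) → Lp ℝ 2 μ),
          S ⊆ boundedDensities μ Γ ∧ IsTEstimator S ψ est ∧
          ∀ s ∈ densitiesL2 μ,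
            (∀ q : ℝ, 1 ≤ q →
              risk μ s n q est ≤ ENNReal.ofReal (C q * Sig *
                ((⨅ m, (Metric.infDist s (model m) + Real.sqrt (Γ * max (D m) (Δ m) / n)))
                  + Real.sqrt (excess μ s Γ)) ^ q)) ∧
            (eLpNorm s ∞ μ ≤ ENNReal.ofReal Γ →
              risk μ s n 2 est ≤ ENNReal.ofReal (C' * Sig *
                ⨅ m, (Metric.infDist s (model m) ^ 2 + Γ * max (D m) (Δ m) / n))) := by
  refine ⟨riskConst, 2 * riskConst 2, ?_⟩
  intro X _ μ _ n hn ι _ model D Δ Sig hne hD hdim hsum hSig Γ hΓ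
  obtain ⟨S, ψ, est, hS, hT, hrisk⟩ := exists_isTEstimator_risk_le hn hne hD hdim hsum hSig hΓ
  -- An empty collection would have total weight `0 < 1`.
  have hι : Nonempty ι := by
    by_contra h
    rw [not_nonempty_iff] at h
    have : Sig = 0 := hsum.unique hasSum_empty
    linarith
  have hΓ0 : 0 ≤ Γ := by linarith
  have hB : ∀ m, 0 ≤ Γ * max (D m) (Δ m) / n := fun m => by
    have : 0 ≤ max (D m) (Δ m) := le_trans (by linarith [hD m]) (le_max_left _ _)
    positivity
  refine ⟨S, ψ, est, hS, hT, fun s hs => ⟨fun q hq => ?_, fun hsΓ => ?_⟩⟩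
  · have hq0 : 0 ≤ q := by linarith
    have hc := riskConst_pos q
    have hf : ∀ m, 0 ≤ Metric.infDist s (model m) + Real.sqrt (Γ * max (D m) (Δ m) / n) :=
      fun m => add_nonneg Metric.infDist_nonneg (Real.sqrt_nonneg _)
    refine le_ofReal_of_forall_le_of_iInf
      (φ := fun x => riskConst q * Sig * (x + Real.sqrt (excess μ s Γ)) ^ q)
      ⟨0, forall_mem_range.2 hf⟩ ?_ ?_ fun m => hrisk s hs q hq0 m
    · exact continuous_const.mul ((continuous_id.add continuous_const).rpow_const
        fun _ => Or.inr hq0)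
    · intro x hx x' _ hxx'
      have hx0 : 0 ≤ x := (Real.iInf_nonneg hf).trans hx
      have := Real.sqrt_nonneg (excess μ s Γ)
      dsimp only
      gcongr
  · have hc := riskConst_pos 2
    refine le_ofReal_of_forall_le_of_iInf (φ := fun x => 2 * riskConst 2 * Sig * x)
      ⟨0, forall_mem_range.2 fun m => add_nonneg (sq_nonneg _) (hB m)⟩ (by fun_prop) ?_ fun m => ?_
    · intro x _ x' _ hxx'
      dsimp only
      gcongr
    · refine (hrisk s hs 2 (by norm_num) m).trans (ENNReal.ofReal_le_ofReal ?_)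
      -- The excess vanishes, and `(a + b)² ≤ 2a² + 2b²` accounts for the factor `2` in the second
      -- constant.
      rw [excess_eq_zero_of_le hΓ0 hsΓ, Real.sqrt_zero, add_zero, Real.rpow_two, mul_assoc 2,
        mul_comm 2, mul_assoc (riskConst 2 * Sig)]
      refine mul_le_mul_of_nonneg_left ?_ (by positivity)
      have h1 := Real.sq_sqrt (hB m)
      nlinarith [sq_nonneg (Metric.infDist s (model m) - Real.sqrt (Γ * max (D m) (Δ m) / n))]
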